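/- Let $a\in\mathbb{C}$, let $h\ge 1$ be an integer and let $d\in\mathbb{R}$. Suppose that $d$ is not an argument of any $h$-th root of $1/a$, i.e. $d$ is not an argument of any $\zeta\in\mathbb{C}$ with $1-a\zeta^h=0$ (if $a=0$ there is no such $\zeta$, and every direction $d$ is allowed). Then the formal power series $$\hat f(z)=\sum_{p\ge 0}(hp+1)!\,a^p z^{hp+1}$$ is $1$-summable in direction $d$. Here, writing $\hat f(z)=\sum_{n\ge0}f_nz^n$, "$1$-summable in direction $d$" means the following. First, $\hat f$ is of Gevrey order $1$: there are $C,A>0$ with $|f_n|\le CA^n n!$ for all $n\ge 0$. Second, there are $\alpha>1$, a sectorial region $G$ with bisecting direction $d$ and opening $\alpha\pi$ on the Riemann surface of the logarithm, and a holomorphic function $f$ on $G$ which admits $\hat f$ as its Gevrey asymptotic expansion of order $1$ in $G$: for every bounded sector $T$ with vertex $0$ such that $\overline{T}\setminus\{0\}\subset G$ there are $C,A>0$ such that $$\Big|f(z)-\sum_{n=0}^{N-1}f_nz^n\Big|\le C A^N N!\,|z|^N\qquad\text{for all } z\in T,\ N\ge 0.$$ A sectorial region with bisecting direction $d$ and opening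 $\alpha\pi$ is a domain $G$ on this surface such that $|\arg z-d|<\alpha\pi/2$ for all $z\in G$, and such that for every $\beta\in(0,\alpha)$ there is $\rho>0$ with $\{z: |\arg z-d|<\beta\pi/2,\ 0<|z|<\rho\}\subset G$. -/

import Mathlib

namespace GevreySummability

/-- The Riemann surface of the logarithm, in its global holomorphic coordinate `w = log z`:
the point with modulus `ρ > 0` and argument `t : ℝ` (not taken modulo `2π`) is
`w = log ρ + t * I`. A function on an open subset of the surface is holomorphic exactly when
it is complex differentiable in this coordinate. -/
abbrev LogSurface : Type := ℂ

namespace LogSurface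

/-- The covering map of the surface onto the punctured plane. -/
noncomputable def toComplex (w : LogSurface) : ℂ := Complex.exp w

/-- The modulus `|z|` of a point of the surface. -/
noncomputable def modulus (w : LogSurface) : ℝ := Real.exp (Complex.re w)

/-- The argument of a point of the surface, an arbitrary real number. -/
def argument (w : LogSurface) : ℝ := Complex.im w

end LogSurface

/-- The unbounded sector `S_d(θ)`, of opening `θπ` and bisecting direction `d`. -/
def unboundedSector (d θ : ℝ) : Set LogSurface :=
  {w | |w.argument - d| < Real.pi * θ / 2}

/-- The bounded sector `S_d(θ, r)`, of opening `θπ`, bisecting direction `d` and radius `r`. -/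
def boundedSector (d θ r : ℝ) : Set LogSurface :=
  {w | |w.argument - d| < Real.pi * θ / 2 ∧ w.modulus < r}

/-- `G` is a sectorial region with bisecting direction `d` and opening `απ`. -/
structure IsSectorialRegion (d α : ℝ) (G : Set LogSurface) : Prop where
  opening_pos : 0 < α
  isOpen : IsOpen G
  isConnected : IsConnected G
  subset_sector : G ⊆ unboundedSector d α
  sector_subset : ∀ β : ℝ, 0 < β → β < α → ∃ ρ : ℝ, 0 < ρ ∧ boundedSector d β ρ ⊆ G

/-- `T` is a bounded proper subsector of `G`: a sector of finite radius whose closure, with the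
vertex removed, lies in `G`. The vertex is not a point of the surface, so this is the closure
in the surface. -/
def IsBoundedProperSubsector (T G : Set LogSurface) : Prop :=
  (∃ d θ r : ℝ, 0 < θ ∧ 0 < r ∧ T = boundedSector d θ r) ∧ closure T ⊆ G

/-- `f` admits `F` as its Gevrey asymptotic expansion of order `s` in `G`. -/
def HasGevreyExpansion (s : ℝ) (G : Set LogSurface) (f : LogSurface → ℂ)
    (F : PowerSeries ℂ) : Prop :=
  ∀ T : Set LogSurface, IsBoundedProperSubsector T G →
    ∃ C A : ℝ, 0 < C ∧ 0 < A ∧ ∀ N : ℕ, ∀ w ∈ T,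
      ‖f w - ∑ p ∈ Finset.range N, PowerSeries.coeff p F * w.toComplex ^ p‖ ≤
        C * A ^ N * (N.factorial : ℝ) ^ s * w.modulus ^ N

/-- The formal power series `F` is of Gevrey order `s`. -/
def IsGevreyOfOrder (s : ℝ) (F : PowerSeries ℂ) : Prop :=
  ∃ C A : ℝ, 0 < C ∧ 0 < A ∧ ∀ p : ℕ,
    ‖PowerSeries.coeff p F‖ ≤ C * A ^ p * (p.factorial : ℝ) ^ s

/-- The formal power series `F` is `k`-summable in direction `d`: it is of Gevrey order `1/k`,
and some holomorphic function on a sectorial region bisected by `d`, of opening larger than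
`π/k`, admits `F` as its Gevrey asymptotic expansion of order `1/k`. -/
def IsSummableInDirection (k d : ℝ) (F : PowerSeries ℂ) : Prop :=
  IsGevreyOfOrder (1 / k) F ∧
    ∃ (α : ℝ) (G : Set LogSurface) (f : LogSurface → ℂ),
      1 / k < α ∧ IsSectorialRegion d α G ∧ DifferentiableOn ℂ f G ∧
        HasGevreyExpansion (1 / k) G f F

/-- The real number `d` is one of the arguments of the nonzero complex number `ζ`. -/
def IsArgumentOf (d : ℝ) (ζ : ℂ) : Prop :=
  ζ ≠ 0 ∧ ζ = (‖ζ‖ : ℂ) * Complex.exp ((d : ℂ) * Complex.I)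

/-- The formal power series `∑_{p ≥ 0} (h p + 1)! a ^ p z ^ (h p + 1)`, for `h ≥ 1`. Any `p` with
`h p + 1 = n` is smaller than `n`, so the sum below runs over all of them. -/
noncomputable def factorialSeries (a : ℂ) (h : ℕ) : PowerSeries ℂ :=
  PowerSeries.mk fun n =>
    ∑ p ∈ Finset.range n, if h * p + 1 = n then ((h * p + 1).factorial : ℂ) * a ^ p else 0

theorem coeff_factorialSeries (a : ℂ) (h : ℕ) (hh : 1 ≤ h) (p : ℕ) :
    PowerSeries.coeff (h * p + 1) (factorialSeries a h) =
      ((h * p + 1).factorial : ℂ) * a ^ p := by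
  rw [factorialSeries, PowerSeries.coeff_mk, Finset.sum_eq_single p]
  · simp
  · intro q _ hq
    rw [if_neg]
    intro h1
    exact hq (Nat.eq_of_mul_eq_mul_left hh (by omega))
  · intro hp
    exact absurd (Finset.mem_range.2 (by nlinarith)) hp

theorem coeff_factorialSeries_eq_zero (a : ℂ) (h n : ℕ) (hn : ∀ p : ℕ, h * p + 1 ≠ n) :
    PowerSeries.coeff n (factorialSeries a h) = 0 := by
  rw [factorialSeries, PowerSeries.coeff_mk]
  exact Finset.sum_eq_zero fun p _ => if_neg (hn p)

end GevreySummability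

/-! The proof is Borel–Laplace summation. Since `∫ u^n e^{-u/z} du/z = n! z^n` along a ray on which
`Re (u/z) > 0`, the series is the termwise Laplace transform of `∑ a^p u^(hp+1) = u / (1 - a u^h)`.
The hypothesis on `d` keeps the poles off the ray of argument `d`, and `exists_denominatorBound`
bounds the denominator below on all rays with argument within some `δ` of `d`. The Laplace integral
along the ray of argument `θ` is holomorphic for `|arg z - θ| < π/2`; letting `θ` vary over `|θ - d|
< δ` covers a sector of opening `π + 2δ > π`.

Two rays admissible for the same `z` give the same value (`DenominatorBound.laplace_eq`). No contour
is deformed: with the ray written `r ↦ r e^τ`, the integral is holomorphic in `τ` and unchanged by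
real translations of `τ`, which only rescale `r`, so its derivative in `τ` vanishes.

For the asymptotics, the geometric series leaves the remainder `a^M u^(hM+1) / (1 - a u^h)`, whose
Laplace integral is of size `(hM+1)! |z|^(hM+1)` up to geometric factors
(`DenominatorBound.norm_laplace_sub_le`). -/

open MeasureTheory Set Filter Topology

namespace GevreySummability

/-! ### Holomorphic parameter integrals -/

/-- An integral of holomorphic functions that are dominated, locally uniformly in the parameter,
by an integrable function is holomorphic in the parameter. -/
theorem differentiableAt_integral_of_norm_le {X : Type*} [MeasurableSpace X] {μ : Measure X}
    {F : ℂ → X → ℂ} {U : Set ℂ} {s₀ : ℂ} {b : X → ℝ} (hU : U ∈ 𝓝 s₀)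
    (hmeas : ∀ s ∈ U, AEStronglyMeasurable (F s) μ)
    (hdiff : ∀ᵐ x ∂μ, DifferentiableOn ℂ (fun s => F s x) U)
    (hbound : ∀ᵐ x ∂μ, ∀ s ∈ U, ‖F s x‖ ≤ b x) (hb : Integrable b μ) :
    DifferentiableAt ℂ (fun s => ∫ x, F s x ∂μ) s₀ := by
  obtain ⟨ε, hε, hball⟩ := Metric.mem_nhds_iff.1 hU
  have hε2 : 0 < ε / 2 := by positivity
  have hmem : s₀ ∈ U := mem_of_mem_nhds hU
  have hdiffAt : ∀ᵐ x ∂μ, ∀ s ∈ Metric.ball s₀ ε, DifferentiableAt ℂ (fun s => F s x) s := by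
    filter_upwards [hdiff] with x hx s hs
    exact (hx.mono hball).differentiableAt (Metric.isOpen_ball.mem_nhds hs)
  -- The derivative is a pointwise limit of difference quotients, with steps at most `ε / 2` so that
  -- the points stay in the ball.
  have hderiv_meas : AEStronglyMeasurable (fun x => deriv (fun s => F s x) s₀) μ := by
    have hv : Tendsto (fun n : ℕ => ((ε / 2 * (1 / ((n : ℝ) + 1)) : ℝ) : ℂ)) atTop (𝓝[≠] 0) := by
      refine tendsto_nhdsWithin_iff.2 ⟨?_, Eventually.of_forall fun n => ?_⟩
      · have := (tendsto_one_div_add_atTop_nhds_zero_nat (𝕜 := ℝ)).const_mul (ε / 2)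
        rw [mul_zero] at this
        have h2 := (Complex.continuous_ofReal.tendsto 0).comp this
        rwa [Complex.ofReal_zero] at h2
      · have : 0 < ε / 2 * (1 / ((n : ℝ) + 1)) := by positivity
        simpa only [mem_compl_iff, mem_singleton_iff, Complex.ofReal_eq_zero] using this.ne'
    refine aestronglyMeasurable_of_tendsto_ae atTop
      (f := fun (n : ℕ) x => ((ε / 2 * (1 / ((n : ℝ) + 1)) : ℝ) : ℂ)⁻¹ •
        (F (s₀ + ((ε / 2 * (1 / ((n : ℝ) + 1)) : ℝ) : ℂ)) x - F s₀ x)) (fun n => ?_) ?_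
    · refine AEStronglyMeasurable.const_smul (𝕜 := ℂ)
        (f := fun x => F (s₀ + ((ε / 2 * (1 / ((n : ℝ) + 1)) : ℝ) : ℂ)) x - F s₀ x)
        ((hmeas _ (hball ?_)).sub (hmeas _ hmem)) _
      have h1 : 1 / ((n : ℝ) + 1) ≤ 1 := by
        rw [div_le_one (by positivity)]
        linarith [(Nat.cast_nonneg n : (0 : ℝ) ≤ n)]
      have h0 : 0 < 1 / ((n : ℝ) + 1) := by positivity
      rw [Metric.mem_ball, dist_eq_norm, add_sub_cancel_left, Complex.norm_real, Real.norm_eq_abs,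
        abs_of_pos (by positivity)]
      nlinarith
    · filter_upwards [hdiffAt] with x hx
      exact ((hx s₀ (Metric.mem_ball_self hε)).hasDerivAt.tendsto_slope_zero).comp hv
  -- Cauchy's estimate on circles of radius `ε / 2` turns the bound `b` on the functions into the
  -- bound `b / (ε / 2)` on their derivatives.
  refine ((hasDerivAt_integral_of_dominated_loc_of_deriv_le (μ := μ) (F := F)
    (F' := fun s x => deriv (fun s => F s x) s) (bound := fun x => b x / (ε / 2))
    (Metric.ball_mem_nhds s₀ hε2) ?_ ?_ hderiv_meas ?_ (hb.div_const _) ?_).2).differentiableAt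
  · filter_upwards [hU] with s hs using hmeas s hs
  · exact hb.mono' (hmeas _ hmem) (hbound.mono fun x hx => hx _ hmem)
  · filter_upwards [hdiffAt, hbound] with x hx hbx s hs
    have hsub : Metric.closedBall s (ε / 2) ⊆ Metric.ball s₀ ε := by
      intro y hy
      rw [Metric.mem_closedBall] at hy
      rw [Metric.mem_ball] at hs ⊢
      linarith [dist_triangle y s s₀]
    refine Complex.norm_deriv_le_of_forall_mem_sphere_norm_le hε2 ?_ fun y hy =>
      hbx y (hball (hsub (Metric.sphere_subset_closedBall hy)))
    refine DifferentiableOn.diffContOnCl fun y hy => (hx y (hsub ?_)).differentiableWithinAt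
    exact Metric.closure_ball_subset_closedBall hy
  · filter_upwards [hdiffAt] with x hx s hs
    exact (hx s (Metric.ball_subset_ball (by linarith) hs)).hasDerivAt

/-! ### Gamma integrals with complex rate -/

theorem integrableOn_pow_mul_exp_neg_mul (n : ℕ) {κ : ℝ} (hκ : 0 < κ) :
    IntegrableOn (fun r : ℝ => r ^ n * Real.exp (-(κ * r))) (Ioi 0) := by
  have hn : (-1 : ℝ) < n := by linarith [(Nat.cast_nonneg n : (0 : ℝ) ≤ n)]
  simpa using integrableOn_rpow_mul_exp_neg_mul_rpow hn one_pos hκ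

theorem norm_exp_neg_ofReal_mul (r : ℝ) (c : ℂ) :
    ‖Complex.exp (-(r * c))‖ = Real.exp (-(c.re * r)) := by
  rw [Complex.norm_exp, Complex.neg_re, Complex.re_ofReal_mul, mul_comm]

theorem integrableOn_pow_mul_cexp_neg_mul (n : ℕ) {c : ℂ} (hc : 0 < c.re) :
    IntegrableOn (fun r : ℝ => (r : ℂ) ^ n * Complex.exp (-(r * c))) (Ioi 0) := by
  refine (integrableOn_pow_mul_exp_neg_mul n hc).mono'
    (Continuous.aestronglyMeasurable (by fun_prop)) ?_
  filter_upwards [ae_restrict_mem measurableSet_Ioi] with r hr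
  rw [norm_mul, norm_exp_neg_ofReal_mul, norm_pow, Complex.norm_real, Real.norm_eq_abs,
    abs_of_pos hr]

theorem integral_pow_mul_cexp_neg_mul (n : ℕ) {c : ℂ} (hc : 0 < c.re) :
    ∫ r : ℝ in Ioi 0, (r : ℂ) ^ n * Complex.exp (-(r * c)) = n.factorial / c ^ (n + 1) := by
  have hc0 : c ≠ 0 := fun h => by simp [h] at hc
  induction n with
  | zero =>
    have := integral_exp_mul_complex_Ioi (a := -c) (by simpa using hc) 0
    simp only [Complex.ofReal_zero, mul_zero, Complex.exp_zero, neg_div_neg_eq] at this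
    simpa [mul_comm, neg_mul] using this
  | succ n ih =>
    -- Integrating this derivative over the half-line gives the recurrence `c * I (n + 1) = (n + 1)
    -- * I n`.
    have hderiv : ∀ r ∈ Ici (0 : ℝ), HasDerivAt
        (fun r : ℝ => (r : ℂ) ^ (n + 1) * Complex.exp (-(r * c)))
        (((n + 1 : ℕ) : ℂ) * ((r : ℂ) ^ n * Complex.exp (-(r * c))) -
          c * ((r : ℂ) ^ (n + 1) * Complex.exp (-(r * c)))) r := by
      intro r _
      have h1 : HasDerivAt (fun z : ℂ => z ^ (n + 1) * Complex.exp (-(z * c)))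
          (((n + 1 : ℕ) : ℂ) * (r : ℂ) ^ n * Complex.exp (-(r * c)) +
            (r : ℂ) ^ (n + 1) * (Complex.exp (-(r * c)) * (-(1 * c)))) (r : ℂ) :=
        (hasDerivAt_pow (n + 1) (r : ℂ)).mul (((hasDerivAt_id (r : ℂ)).mul_const c).neg.cexp)
      convert h1.comp_ofReal using 1
      ring
    have hlim : Tendsto (fun r : ℝ => (r : ℂ) ^ (n + 1) * Complex.exp (-(r * c))) atTop (𝓝 0) := by
      rw [tendsto_zero_iff_norm_tendsto_zero]
      have h2 := tendsto_rpow_mul_exp_neg_mul_atTop_nhds_zero ((n + 1 : ℕ) : ℝ) c.re hc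
      refine h2.congr' ?_
      filter_upwards [eventually_gt_atTop 0] with r hr
      rw [norm_mul, norm_exp_neg_ofReal_mul, norm_pow, Complex.norm_real, Real.norm_eq_abs,
        abs_of_pos hr, Real.rpow_natCast, neg_mul]
    have hi0 := (integrableOn_pow_mul_cexp_neg_mul n hc).const_mul ((n + 1 : ℕ) : ℂ)
    have hi1 := (integrableOn_pow_mul_cexp_neg_mul (n + 1) hc).const_mul c
    have key := integral_Ioi_of_hasDerivAt_of_tendsto' hderiv (hi0.sub hi1) hlim
    rw [integral_sub hi0 hi1, integral_const_mul, integral_const_mul, ih] at key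
    have key' : c * ∫ r : ℝ in Ioi 0, (r : ℂ) ^ (n + 1) * Complex.exp (-(r * c)) =
        ((n + 1 : ℕ) : ℂ) * (n.factorial / c ^ (n + 1)) := by
      have h0 : ((0 : ℝ) : ℂ) ^ (n + 1) * Complex.exp (-(((0 : ℝ) : ℂ) * c)) = 0 := by simp
      rw [h0, sub_zero] at key
      exact (sub_eq_zero.1 key).symm
    apply mul_left_cancel₀ hc0
    rw [key', Nat.factorial_succ]
    push_cast
    field_simp
    ring

theorem integral_pow_mul_exp_neg_mul (n : ℕ) {κ : ℝ} (hκ : 0 < κ) :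
    ∫ r : ℝ in Ioi 0, r ^ n * Real.exp (-(κ * r)) = n.factorial / κ ^ (n + 1) := by
  have := integral_pow_mul_cexp_neg_mul n (c := κ) (by simpa using hκ)
  apply Complex.ofReal_injective
  rw [← integral_complex_ofReal]
  push_cast
  rw [← this]
  simp only [mul_comm]

theorem factorial_add_le (N h : ℕ) :
    (N + h).factorial ≤ 2 ^ (N + h) * N.factorial * h.factorial := by
  rw [← Nat.add_choose_mul_factorial_mul_factorial N h]
  gcongr
  exact Nat.choose_le_two_pow _ _

/-! ### Laplace transform along a ray -/

/-- The integrand of the Laplace transform of `u / (1 - a u ^ h)` at the point `w` of the surface,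
along the ray with parametrization `r ↦ r * exp τ`. -/
noncomputable def laplaceKernel (a : ℂ) (h : ℕ) (τ w : ℂ) (r : ℝ) : ℂ :=
  r * Complex.exp τ / (1 - a * (r * Complex.exp τ) ^ h) *
    Complex.exp (-(r * Complex.exp (τ - w))) * Complex.exp (τ - w)

/-- The Laplace transform of `u / (1 - a u ^ h)` along the ray spanned by `exp τ`. -/
noncomputable def laplace (a : ℂ) (h : ℕ) (τ w : ℂ) : ℂ :=
  ∫ r : ℝ in Ioi 0, laplaceKernel a h τ w r

/-- On all rays with an argument `δ`-close to `d`, the denominator `1 - a u ^ h` is bounded away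
from zero by `c`. -/
def DenominatorBound (a : ℂ) (h : ℕ) (d δ c : ℝ) : Prop :=
  ∀ τ : ℂ, |τ.im - d| < δ → ∀ r : ℝ, 0 ≤ r → c ≤ ‖1 - a * (r * Complex.exp τ) ^ h‖

theorem aestronglyMeasurable_laplaceKernel (a : ℂ) (h : ℕ) (τ w : ℂ) :
    AEStronglyMeasurable (laplaceKernel a h τ w) (volume.restrict (Ioi 0)) := by
  refine Measurable.aestronglyMeasurable ?_
  unfold laplaceKernel
  fun_prop

variable {a : ℂ} {h : ℕ} {d δ c : ℝ}

theorem DenominatorBound.ne_zero (H : DenominatorBound a h d δ c) (hc : 0 < c) {τ : ℂ}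
    (hτ : |τ.im - d| < δ) {r : ℝ} (hr : 0 ≤ r) : 1 - a * (r * Complex.exp τ) ^ h ≠ 0 :=
  norm_pos_iff.1 (hc.trans_le (H τ hτ r hr))

theorem DenominatorBound.norm_laplaceKernel_le (H : DenominatorBound a h d δ c) (hc : 0 < c)
    {τ : ℂ} (hτ : |τ.im - d| < δ) (w : ℂ) {r : ℝ} (hr : 0 < r) :
    ‖laplaceKernel a h τ w r‖ ≤ ‖Complex.exp τ‖ * ‖Complex.exp (τ - w)‖ / c *
      (r ^ 1 * Real.exp (-((Complex.exp (τ - w)).re * r))) := by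
  have hd := H τ hτ r hr.le
  rw [laplaceKernel, norm_mul, norm_mul, norm_exp_neg_ofReal_mul, norm_div, norm_mul,
    Complex.norm_real, Real.norm_eq_abs, abs_of_pos hr, pow_one]
  calc r * ‖Complex.exp τ‖ / ‖1 - a * (r * Complex.exp τ) ^ h‖ *
        Real.exp (-((Complex.exp (τ - w)).re * r)) * ‖Complex.exp (τ - w)‖
      ≤ r * ‖Complex.exp τ‖ / c *
        Real.exp (-((Complex.exp (τ - w)).re * r)) * ‖Complex.exp (τ - w)‖ := by gcongr
    _ = _ := by ring

theorem DenominatorBound.integrableOn_laplaceKernel (H : DenominatorBound a h d δ c) (hc : 0 < c)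
    {τ w : ℂ} (hτ : |τ.im - d| < δ) (hw : 0 < (Complex.exp (τ - w)).re) :
    IntegrableOn (laplaceKernel a h τ w) (Ioi 0) := by
  refine ((integrableOn_pow_mul_exp_neg_mul 1 hw).const_mul
    (‖Complex.exp τ‖ * ‖Complex.exp (τ - w)‖ / c)).mono'
    (aestronglyMeasurable_laplaceKernel a h τ w) ?_
  filter_upwards [ae_restrict_mem measurableSet_Ioi] with r hr
  exact H.norm_laplaceKernel_le hc hτ w hr

/-- Both `τ` and `w` may depend on the parameter: moving `τ` serves the rotation of the ray, moving
`w` the holomorphy of the sum. Near `s₀` the decay rate stays above half its value, which yields an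
integrable majorant. -/
theorem DenominatorBound.differentiableAt_laplace (H : DenominatorBound a h d δ c) (hc : 0 < c)
    {τ w : ℂ → ℂ} (hτ : Differentiable ℂ τ) (hw : Differentiable ℂ w) {s₀ : ℂ}
    (hs₀ : |(τ s₀).im - d| < δ) (hs₀' : 0 < (Complex.exp (τ s₀ - w s₀)).re) :
    DifferentiableAt ℂ (fun s => laplace a h (τ s) (w s)) s₀ := by
  set κ := (Complex.exp (τ s₀ - w s₀)).re / 2 with hκ_def
  have hκ : 0 < κ := by positivity
  set K := ‖Complex.exp (τ s₀)‖ * ‖Complex.exp (τ s₀ - w s₀)‖ + 1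
  have hτc := hτ.continuous
  have hwc := hw.continuous
  have hopen : {s : ℂ | |(τ s).im - d| < δ} ∩ {s | κ < (Complex.exp (τ s - w s)).re} ∩
      {s | ‖Complex.exp (τ s)‖ * ‖Complex.exp (τ s - w s)‖ < K} ∈ 𝓝 s₀ := by
    refine inter_mem (inter_mem ?_ ?_) ?_
    · exact (isOpen_lt (by fun_prop) continuous_const).mem_nhds hs₀
    · refine (isOpen_lt continuous_const ?_).mem_nhds (half_lt_self hs₀')
      exact Complex.continuous_re.comp (by fun_prop)
    · exact (isOpen_lt (by fun_prop) continuous_const).mem_nhds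
        (lt_add_one (‖Complex.exp (τ s₀)‖ * ‖Complex.exp (τ s₀ - w s₀)‖))
  refine differentiableAt_integral_of_norm_le hopen
    (b := fun r => K / c * (r ^ 1 * Real.exp (-(κ * r))))
    (fun s _ => aestronglyMeasurable_laplaceKernel a h _ _) ?_ ?_
    ((integrableOn_pow_mul_exp_neg_mul 1 hκ).const_mul _)
  · filter_upwards [ae_restrict_mem measurableSet_Ioi] with r hr s hs
    have hne := H.ne_zero hc hs.1.1 (le_of_lt hr)
    refine DifferentiableAt.differentiableWithinAt ?_
    have h1 := hτ s
    have h2 := hw s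
    unfold laplaceKernel
    fun_prop (disch := exact hne)
  · filter_upwards [ae_restrict_mem measurableSet_Ioi] with r hr s hs
    have hr' : 0 < r := hr
    refine (H.norm_laplaceKernel_le hc hs.1.1 _ hr').trans ?_
    have h2 : κ ≤ (Complex.exp (τ s - w s)).re := le_of_lt hs.1.2
    have h3 : ‖Complex.exp (τ s)‖ * ‖Complex.exp (τ s - w s)‖ ≤ K := le_of_lt hs.2
    gcongr

theorem laplace_add_ofReal (a : ℂ) (h : ℕ) (τ w : ℂ) (s : ℝ) :
    laplace a h (τ + s) w = laplace a h τ w := by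
  have key := integral_comp_mul_left_Ioi (laplaceKernel a h τ w) 0 (Real.exp_pos s)
  rw [mul_zero] at key
  have hs : (Real.exp s : ℝ) ≠ 0 := (Real.exp_pos s).ne'
  calc laplace a h (τ + s) w
      = ∫ r : ℝ in Ioi 0, Real.exp s • laplaceKernel a h τ w (Real.exp s * r) := by
        refine setIntegral_congr_fun measurableSet_Ioi fun r _ => ?_
        simp only [laplaceKernel, Complex.real_smul, Complex.ofReal_mul, Complex.ofReal_exp]
        rw [show τ + s - w = s + (τ - w) by ring, add_comm τ, Complex.exp_add, Complex.exp_add,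
          show (r : ℂ) * (Complex.exp s * Complex.exp τ) = Complex.exp s * r * Complex.exp τ by ring,
          show (r : ℂ) * (Complex.exp s * Complex.exp (τ - w)) =
            Complex.exp s * r * Complex.exp (τ - w) by ring]
        ring
    _ = laplace a h τ w := by
        rw [integral_smul, key, smul_smul, mul_inv_cancel₀ hs, one_smul, laplace]

theorem exp_re_pos {z : ℂ} (hz : |z.im| < Real.pi / 2) : 0 < (Complex.exp z).re := by
  rw [Complex.exp_re]
  exact mul_pos (Real.exp_pos _) (Real.cos_pos_of_mem_Ioo (abs_lt.1 hz))

theorem DenominatorBound.laplace_eq (H : DenominatorBound a h d δ c) (hc : 0 < c) {τ₁ τ₂ w : ℂ}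
    (h₁ : |τ₁.im - d| < δ) (h₁' : |(τ₁ - w).im| < Real.pi / 2)
    (h₂ : |τ₂.im - d| < δ) (h₂' : |(τ₂ - w).im| < Real.pi / 2) :
    laplace a h τ₁ w = laplace a h τ₂ w := by
  set S : Set ℂ := Complex.imLm ⁻¹' (Metric.ball d δ ∩ Metric.ball w.im (Real.pi / 2)) with hS
  have hmem : ∀ τ : ℂ, τ ∈ S ↔ |τ.im - d| < δ ∧ |(τ - w).im| < Real.pi / 2 := fun τ => by
    simp [hS, Real.dist_eq]
  have hSo : IsOpen S := (Metric.isOpen_ball.inter Metric.isOpen_ball).preimage Complex.continuous_im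
  have hSc : Convex ℝ S := ((convex_ball d δ).inter (convex_ball w.im _)).linear_preimage _
  have hdiff : ∀ τ ∈ S, DifferentiableAt ℂ (fun τ => laplace a h τ w) τ := fun τ hτ =>
    H.differentiableAt_laplace hc differentiable_id (differentiable_const w) ((hmem τ).1 hτ).1
      (exp_re_pos ((hmem τ).1 hτ).2)
  refine hSo.is_const_of_deriv_eq_zero (f := fun τ => laplace a h τ w) hSc.isPreconnected
    (fun τ hτ => (hdiff τ hτ).differentiableWithinAt) (fun τ hτ => ?_)
    ((hmem _).2 ⟨h₁, h₁'⟩) ((hmem _).2 ⟨h₂, h₂'⟩)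
  -- The complex derivative can be computed along real increments, where `laplace_add_ofReal` makes
  -- the function constant.
  have h1 : HasDerivAt (fun s : ℂ => laplace a h (τ + s) w)
      (deriv (fun τ => laplace a h τ w) τ) ((0 : ℝ) : ℂ) := by
    have := (hdiff τ hτ).hasDerivAt
    rw [Complex.ofReal_zero]
    rw [← add_zero τ] at this
    simpa using HasDerivAt.comp_const_add τ 0 this
  have h2 := h1.comp_ofReal
  simp only [laplace_add_ofReal] at h2
  exact h2.unique (hasDerivAt_const _ _)

theorem laplace_monomial (n : ℕ) {τ w : ℂ} (hw : 0 < (Complex.exp (τ - w)).re) :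
    ∫ r : ℝ in Ioi 0, (r * Complex.exp τ) ^ n * Complex.exp (-(r * Complex.exp (τ - w))) *
      Complex.exp (τ - w) = n.factorial * Complex.exp w ^ n := by
  have : ∀ r : ℝ, (r * Complex.exp τ) ^ n * Complex.exp (-(r * Complex.exp (τ - w))) *
      Complex.exp (τ - w) = Complex.exp τ ^ n * Complex.exp (τ - w) *
        ((r : ℂ) ^ n * Complex.exp (-(r * Complex.exp (τ - w)))) := fun r => by ring
  simp_rw [this]
  rw [integral_const_mul, integral_pow_mul_cexp_neg_mul n hw, Complex.exp_sub]
  have h1 := Complex.exp_ne_zero τ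
  have h2 := Complex.exp_ne_zero w
  rw [div_pow]
  field_simp
  ring

theorem integrableOn_laplace_monomial (n : ℕ) {τ w : ℂ} (hw : 0 < (Complex.exp (τ - w)).re) :
    IntegrableOn (fun r : ℝ => (r * Complex.exp τ) ^ n *
      Complex.exp (-(r * Complex.exp (τ - w))) * Complex.exp (τ - w)) (Ioi 0) := by
  refine ((integrableOn_pow_mul_cexp_neg_mul n hw).const_mul
    (Complex.exp τ ^ n * Complex.exp (τ - w))).congr (ae_of_all _ fun r => ?_)
  ring

theorem geom_remainder {a u : ℂ} {h : ℕ} (hu : 1 - a * u ^ h ≠ 0) (M : ℕ) :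
    u / (1 - a * u ^ h) - ∑ p ∈ Finset.range M, a ^ p * u ^ (h * p + 1) =
      a ^ M * u ^ (h * M + 1) / (1 - a * u ^ h) := by
  have h1 : ∑ p ∈ Finset.range M, a ^ p * u ^ (h * p + 1) =
      u * ∑ p ∈ Finset.range M, (a * u ^ h) ^ p := by
    rw [Finset.mul_sum]
    exact Finset.sum_congr rfl fun p _ => by ring
  have h2 := mul_neg_geom_sum (a * u ^ h) M
  rw [h1, eq_div_iff hu, sub_mul, div_mul_cancel₀ _ hu,
    show u * (∑ p ∈ Finset.range M, (a * u ^ h) ^ p) * (1 - a * u ^ h) =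
      u * ((1 - a * u ^ h) * ∑ p ∈ Finset.range M, (a * u ^ h) ^ p) by ring, h2]
  ring

theorem DenominatorBound.norm_laplace_sub_le (H : DenominatorBound a h d δ c) (hc : 0 < c)
    {τ w : ℂ} (hτ : |τ.im - d| < δ) (hw : 0 < (Complex.exp (τ - w)).re) (M : ℕ) :
    ‖laplace a h τ w - ∑ p ∈ Finset.range M,
        ((h * p + 1).factorial * a ^ p) * Complex.exp w ^ (h * p + 1)‖ ≤
      ‖a‖ ^ M * ‖Complex.exp τ‖ ^ (h * M + 1) * ‖Complex.exp (τ - w)‖ / c *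
        ((h * M + 1).factorial / (Complex.exp (τ - w)).re ^ (h * M + 1 + 1)) := by
  have hint : ∀ p ∈ Finset.range M, IntegrableOn (fun r : ℝ => a ^ p *
      ((r * Complex.exp τ) ^ (h * p + 1) * Complex.exp (-(r * Complex.exp (τ - w))) *
        Complex.exp (τ - w))) (Ioi 0) := fun p _ =>
    (integrableOn_laplace_monomial (h * p + 1) hw).const_mul (a ^ p)
  have hsum : ∑ p ∈ Finset.range M, ((h * p + 1).factorial * a ^ p) *
      Complex.exp w ^ (h * p + 1) = ∫ r : ℝ in Ioi 0, ∑ p ∈ Finset.range M, a ^ p *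
        ((r * Complex.exp τ) ^ (h * p + 1) * Complex.exp (-(r * Complex.exp (τ - w))) *
          Complex.exp (τ - w)) := by
    rw [integral_finsetSum _ hint]
    refine Finset.sum_congr rfl fun p _ => ?_
    rw [integral_const_mul, laplace_monomial _ hw]
    ring
  rw [hsum, laplace, ← integral_sub (H.integrableOn_laplaceKernel hc hτ hw)
    (integrable_finsetSum _ hint), ← integral_pow_mul_exp_neg_mul _ hw, ← integral_const_mul]
  refine norm_integral_le_of_norm_le ((integrableOn_pow_mul_exp_neg_mul _ hw).const_mul _) ?_
  filter_upwards [ae_restrict_mem measurableSet_Ioi] with r hr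
  have hr' : 0 < r := hr
  have hb := H τ hτ r hr'.le
  have heq : laplaceKernel a h τ w r - ∑ p ∈ Finset.range M, a ^ p *
      ((r * Complex.exp τ) ^ (h * p + 1) * Complex.exp (-(r * Complex.exp (τ - w))) *
        Complex.exp (τ - w)) = a ^ M * (r * Complex.exp τ) ^ (h * M + 1) /
        (1 - a * (r * Complex.exp τ) ^ h) * Complex.exp (-(r * Complex.exp (τ - w))) *
        Complex.exp (τ - w) := by
    rw [← geom_remainder (H.ne_zero hc hτ hr'.le), laplaceKernel, sub_mul, sub_mul,
      Finset.sum_mul, Finset.sum_mul]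
    simp only [mul_assoc]
  rw [heq, norm_mul, norm_mul, norm_exp_neg_ofReal_mul, norm_div, norm_mul, norm_pow, norm_pow,
    norm_mul, Complex.norm_real, Real.norm_eq_abs, abs_of_pos hr']
  calc ‖a‖ ^ M * (r * ‖Complex.exp τ‖) ^ (h * M + 1) / ‖1 - a * (r * Complex.exp τ) ^ h‖ *
        Real.exp (-((Complex.exp (τ - w)).re * r)) * ‖Complex.exp (τ - w)‖
      ≤ ‖a‖ ^ M * (r * ‖Complex.exp τ‖) ^ (h * M + 1) / c *
        Real.exp (-((Complex.exp (τ - w)).re * r)) * ‖Complex.exp (τ - w)‖ := by gcongr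
    _ = _ := by rw [mul_pow]; ring

/-! ### Lower bound for the denominator -/

theorem norm_one_sub_le_two_mul {β : ℂ} (hβ : ‖β‖ = 1) {s : ℝ} (hs : 0 ≤ s) :
    ‖1 - β‖ ≤ 2 * ‖1 - s * β‖ := by
  have h1 : ‖(s : ℂ) * β‖ = s := by
    rw [norm_mul, hβ, mul_one, Complex.norm_real, Real.norm_eq_abs, abs_of_nonneg hs]
  have h2 : ‖((s : ℂ) - 1) * β‖ = |s - 1| := by
    rw [norm_mul, hβ, mul_one, ← Complex.ofReal_one, ← Complex.ofReal_sub, Complex.norm_real,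
      Real.norm_eq_abs]
  have h3 : |s - 1| ≤ ‖1 - s * β‖ := by
    have := abs_norm_sub_norm_le ((s : ℂ) * β) 1
    rwa [h1, norm_one, norm_sub_rev] at this
  calc ‖1 - β‖ = ‖(1 - s * β) + ((s : ℂ) - 1) * β‖ := by congr 1; ring
    _ ≤ ‖1 - s * β‖ + |s - 1| := (norm_add_le _ _).trans_eq (by rw [h2])
    _ ≤ _ := by linarith

/-- On the ray of argument `x`, `a u^h` runs through the nonnegative multiples of the unit number `β
x`. By `norm_one_sub_le_two_mul` the distance from `1` to that half-line is at least `‖1 - β x‖ /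
2`, so continuity of `β` at `d` and `β d ≠ 1` suffice. -/
theorem exists_denominatorBound (hh : 1 ≤ h)
    (hd : ∀ ζ : ℂ, a ≠ 0 → ζ ^ h = 1 / a → ¬ IsArgumentOf d ζ) :
    ∃ δ c : ℝ, 0 < δ ∧ 0 < c ∧ DenominatorBound a h d δ c := by
  rcases eq_or_ne a 0 with rfl | ha
  · exact ⟨1, 1, one_pos, one_pos, fun τ _ r _ => by simp⟩
  have hna : 0 < ‖a‖ := norm_pos_iff.2 ha
  have hna' : (‖a‖ : ℂ) ≠ 0 := Complex.ofReal_ne_zero.2 hna.ne'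
  set β : ℝ → ℂ := fun x => a / ‖a‖ * Complex.exp (x * Complex.I) ^ h with hβ_def
  have hβ_cont : Continuous β := by fun_prop
  have hβ_norm : ∀ x, ‖β x‖ = 1 := fun x => by
    rw [hβ_def]
    simp only [norm_mul, norm_div, norm_pow, Complex.norm_exp_ofReal_mul_I, Complex.norm_real,
      norm_norm, one_pow, mul_one]
    exact div_self hna.ne'
  have hβ_ne : β d ≠ 1 := by
    intro hβ1
    -- The common modulus of the `h`-th roots of `1 / a`; if `β d = 1`, the point of this modulus
    -- and argument `d` is such a root.
    set ρ : ℝ := ‖a‖⁻¹ ^ ((h : ℝ)⁻¹)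
    have hρ : 0 < ρ := Real.rpow_pos_of_pos (inv_pos.2 hna) _
    have hρh : ρ ^ h = ‖a‖⁻¹ := Real.rpow_inv_natCast_pow (inv_pos.2 hna).le (by omega)
    have hnorm : ‖(ρ : ℂ) * Complex.exp (d * Complex.I)‖ = ρ := by
      rw [norm_mul, Complex.norm_exp_ofReal_mul_I, mul_one, Complex.norm_real, Real.norm_eq_abs,
        abs_of_pos hρ]
    refine hd (ρ * Complex.exp (d * Complex.I)) ha ?_ ⟨?_, by rw [hnorm]⟩
    · rw [mul_pow, ← Complex.ofReal_pow, hρh, eq_div_iff ha, Complex.ofReal_inv, ← hβ1]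
      simp only [hβ_def]
      field_simp
    · exact norm_pos_iff.1 (hρ.trans_eq hnorm.symm)
  have hpos : 0 < ‖1 - β d‖ := norm_pos_iff.2 (sub_ne_zero.2 hβ_ne.symm)
  obtain ⟨δ, hδ, hδβ⟩ := Metric.mem_nhds_iff.1
    ((isOpen_lt continuous_const (by fun_prop : Continuous fun x => ‖1 - β x‖)).mem_nhds
      (half_lt_self hpos : ‖1 - β d‖ / 2 < ‖1 - β d‖))
  -- One factor `1/2` is lost to continuity in the argument, the other to `norm_one_sub_le_two_mul`.
  refine ⟨δ, ‖1 - β d‖ / 4, hδ, by positivity, fun τ hτ r hr => ?_⟩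
  have h1 : ‖1 - β d‖ / 2 < ‖1 - β τ.im‖ := hδβ (by rwa [Metric.mem_ball, Real.dist_eq])
  have h2 := norm_one_sub_le_two_mul (hβ_norm τ.im)
    (by positivity : 0 ≤ ‖a‖ * (r * Real.exp τ.re) ^ h)
  have h3 : a * (r * Complex.exp τ) ^ h =
      ((‖a‖ * (r * Real.exp τ.re) ^ h : ℝ) : ℂ) * β τ.im := by
    conv_lhs => rw [← Complex.re_add_im τ, Complex.exp_add]
    simp only [hβ_def]
    push_cast
    field_simp
    ring
  rw [h3]
  linarith

/-! ### Coefficients and partial sums of the series -/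

theorem isGevreyOfOrder_factorialSeries (a : ℂ) (hh : 1 ≤ h) :
    IsGevreyOfOrder 1 (factorialSeries a h) := by
  refine ⟨1, max 1 ‖a‖, one_pos, by positivity, fun n => ?_⟩
  rw [Real.rpow_one, one_mul]
  by_cases hn : ∃ p, h * p + 1 = n
  · obtain ⟨p, rfl⟩ := hn
    rw [coeff_factorialSeries a h hh, norm_mul, norm_pow, Complex.norm_natCast, mul_comm]
    gcongr
    calc ‖a‖ ^ p ≤ max 1 ‖a‖ ^ p := by gcongr; exact le_max_right _ _
      _ ≤ max 1 ‖a‖ ^ (h * p + 1) := pow_le_pow_right₀ (le_max_left _ _) (by nlinarith)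
  · rw [coeff_factorialSeries_eq_zero a h n (not_exists.1 hn), norm_zero]
    positivity

/-- The partial sums of `factorialSeries` consist of its first few nonzero terms. -/
theorem exists_sum_coeff_factorialSeries (a : ℂ) (hh : 1 ≤ h) (z : ℂ) (N : ℕ) :
    ∃ M : ℕ, N ≤ h * M + 1 ∧ h * M + 1 ≤ N + h ∧ M ≤ N ∧
      ∑ n ∈ Finset.range N, PowerSeries.coeff n (factorialSeries a h) * z ^ n =
        ∑ p ∈ Finset.range M, ((h * p + 1).factorial * a ^ p) * z ^ (h * p + 1) := by
  -- `M` counts the exponents `h * p + 1` below `N`; in this form the condition passes through the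
  -- induction, and `p = M - 1` gives both upper bounds.
  suffices ∃ M : ℕ, N ≤ h * M + 1 ∧ (∀ p < M, h * p + 1 < N) ∧
      ∑ n ∈ Finset.range N, PowerSeries.coeff n (factorialSeries a h) * z ^ n =
        ∑ p ∈ Finset.range M, ((h * p + 1).factorial * a ^ p) * z ^ (h * p + 1) by
    obtain ⟨M, h1, h2, h3⟩ := this
    refine ⟨M, h1, ?_, ?_, h3⟩
    · cases M with
      | zero => omega
      | succ M => have := h2 M (Nat.lt_succ_self M); rw [mul_add]; omega
    · cases M with
      | zero => omega
      | succ M => have := h2 M (Nat.lt_succ_self M); nlinarith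
  induction N with
  | zero => exact ⟨0, by omega, by simp, by simp⟩
  | succ N ih =>
    obtain ⟨M, h1, h2, h3⟩ := ih
    rcases h1.eq_or_lt with heq | hlt
    · refine ⟨M + 1, by nlinarith, fun p hp => ?_, ?_⟩
      · have := Nat.mul_le_mul_left h (Nat.lt_succ_iff.1 hp)
        omega
      · rw [Finset.sum_range_succ, Finset.sum_range_succ, h3, heq, coeff_factorialSeries a h hh]
    · refine ⟨M, hlt, fun p hp => (h2 p hp).trans (Nat.lt_succ_self N), ?_⟩
      rw [Finset.sum_range_succ, h3, coeff_factorialSeries_eq_zero, zero_mul, add_zero]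
      intro p hp
      rcases lt_or_ge p M with hpM | hpM
      · exact (h2 p hpM).ne hp
      · have := Nat.mul_le_mul_left h hpM
        omega

/-! ### Sectors and their proper subsectors -/

theorem mem_unboundedSector {d θ : ℝ} {w : ℂ} :
    w ∈ unboundedSector d θ ↔ |w.im - d| < Real.pi * θ / 2 := Iff.rfl

theorem isSectorialRegion_unboundedSector (d : ℝ) {α : ℝ} (hα : 0 < α) :
    IsSectorialRegion d α (unboundedSector d α) where
  opening_pos := hα
  isOpen := isOpen_lt (by unfold LogSurface.argument; fun_prop) continuous_const
  isConnected := by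
    have hS : unboundedSector d α = Complex.imLm ⁻¹' Metric.ball d (Real.pi * α / 2) := by
      ext w
      simp [mem_unboundedSector, Real.dist_eq]
    refine ⟨⟨(d : ℂ) * Complex.I, ?_⟩, ?_⟩
    · rw [mem_unboundedSector]
      simpa using by positivity
    · rw [hS]
      exact ((convex_ball d _).linear_preimage _).isPreconnected
  subset_sector := Subset.rfl
  sector_subset := fun β _ hβα => ⟨1, one_pos, fun w hw => hw.1.trans (by gcongr)⟩

/-- A bounded proper subsector of an unbounded sector has bounded radius, and its arguments stay
away from the boundary of the unbounded sector. -/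
theorem IsBoundedProperSubsector.exists_bounds {d α : ℝ} {T : Set LogSurface}
    (hT : IsBoundedProperSubsector T (unboundedSector d α)) :
    ∃ m R : ℝ, 0 ≤ m ∧ m < Real.pi * α / 2 ∧
      ∀ w ∈ T, |w.im - d| ≤ m ∧ w.modulus ≤ R := by
  obtain ⟨⟨d', θ, r, hθ, hr, rfl⟩, hcl⟩ := hT
  set x₀ : ℝ := Real.log (r / 2)
  have hpθ : 0 < Real.pi * θ / 2 := by positivity
  -- A point of modulus `r / 2` on either bounding ray of `T` is a limit of points of `T`, hence
  -- lies in the larger open sector. This makes the bound `m` strict.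
  have hedge : ∀ ε : ℝ, |ε| = 1 → |d' + ε * (Real.pi * θ / 2) - d| < Real.pi * α / 2 := by
    intro ε hε
    have hf : Continuous fun s : ℝ =>
        ((x₀ : ℂ) + ((d' + s * (ε * (Real.pi * θ / 2)) : ℝ) : ℂ) * Complex.I) := by fun_prop
    have h1 : (1 : ℝ) ∈ closure (Ico (0 : ℝ) 1) := by
      rw [closure_Ico zero_ne_one]
      exact right_mem_Icc.2 zero_le_one
    have h2 := hcl (map_mem_closure (t := boundedSector d' θ r) hf h1 fun s hs => ?_)
    · rw [mem_unboundedSector] at h2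
      simpa using h2
    · refine ⟨?_, ?_⟩
      · have : ((x₀ : ℂ) + ((d' + s * (ε * (Real.pi * θ / 2)) : ℝ) : ℂ) * Complex.I).im - d' =
            s * (ε * (Real.pi * θ / 2)) := by
          simp [-Complex.ofReal_add, -Complex.ofReal_mul]
        rw [LogSurface.argument, this, abs_mul, abs_mul, hε, abs_of_pos hpθ, abs_of_nonneg hs.1]
        nlinarith [hs.2]
      · have : ((x₀ : ℂ) + ((d' + s * (ε * (Real.pi * θ / 2)) : ℝ) : ℂ) * Complex.I).re = x₀ := by
          simp [-Complex.ofReal_add, -Complex.ofReal_mul]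
        rw [LogSurface.modulus, this, Real.exp_log (by positivity)]
        linarith
  refine ⟨max |d' + 1 * (Real.pi * θ / 2) - d| |d' + -1 * (Real.pi * θ / 2) - d|, r,
    (abs_nonneg _).trans (le_max_left _ _),
    max_lt (hedge 1 (by simp)) (hedge (-1) (by simp)), fun w hw => ⟨?_, hw.2.le⟩⟩
  have hw1 := abs_lt.1 (show |w.im - d'| < Real.pi * θ / 2 from hw.1)
  rw [max_comm]
  exact abs_le_max_abs_abs (by linarith) (by linarith)

/-! ### The Borel sum and its asymptotics -/

/-- The argument of the integration ray used for points with the argument `t`. -/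
noncomputable def rayArgument (d α t : ℝ) : ℝ := d + (1 - 1 / α) * (t - d)

/-- The weights `1 - 1/α` and `1/α` split the range `|t - d| < πα/2`: the ray is within `(α - 1)π/2`
of `d` and within `π/2` of `t`. -/
theorem abs_rayArgument_sub {d α t : ℝ} (hα : 1 < α) :
    |rayArgument d α t - d| = (1 - 1 / α) * |t - d| := by
  have : 0 ≤ 1 - 1 / α := by
    rw [sub_nonneg, div_le_one (by linarith)]
    exact hα.le
  rw [rayArgument, add_sub_cancel_left, abs_mul, abs_of_nonneg this]

theorem abs_rayArgument_sub_self {d α t : ℝ} (hα : 1 < α) :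
    |rayArgument d α t - t| = |t - d| / α := by
  have : rayArgument d α t - t = -((t - d) / α) := by
    rw [rayArgument]
    ring
  rw [this, abs_neg, abs_div, abs_of_pos (by linarith : 0 < α)]

/-- The sum of `factorialSeries a h` on the sector of opening `α π` bisected by `d`. -/
noncomputable def borelSum (a : ℂ) (h : ℕ) (d α : ℝ) (w : LogSurface) : ℂ :=
  laplace a h (rayArgument d α w.im * Complex.I) w

theorem DenominatorBound.differentiableOn_borelSum (H : DenominatorBound a h d δ c) (hc : 0 < c)
    {α : ℝ} (hα : 1 < α) (hδ : (α - 1) * (Real.pi / 2) ≤ δ) :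
    DifferentiableOn ℂ (borelSum a h d α) (unboundedSector d α) := by
  have hα0 : 0 < α := by linarith
  have hopen := (isSectorialRegion_unboundedSector d hα0).isOpen
  have hray : ∀ w ∈ unboundedSector d α,
      |((rayArgument d α w.im : ℂ) * Complex.I).im - d| < δ ∧
        |((rayArgument d α w.im : ℂ) * Complex.I - w).im| < Real.pi / 2 := by
    intro w hw
    rw [mem_unboundedSector] at hw
    have h1 : 0 < 1 - 1 / α := by
      rw [sub_pos, div_lt_one hα0]
      exact hα
    rw [Complex.sub_im, Complex.im_ofReal_mul, Complex.I_im, mul_one, abs_rayArgument_sub hα,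
      abs_rayArgument_sub_self hα]
    constructor
    · calc (1 - 1 / α) * |w.im - d| < (1 - 1 / α) * (Real.pi * α / 2) := by gcongr
        _ = (α - 1) * (Real.pi / 2) := by field_simp
        _ ≤ δ := hδ
    · rw [div_lt_iff₀ hα0]
      linarith
  intro w hw
  refine DifferentiableAt.differentiableWithinAt ?_
  -- The ray in `borelSum` depends on `w` through `w.im`, which is not holomorphic. Near `w` it is
  -- therefore frozen at the ray chosen for `w`, without changing the value.
  have hd := H.differentiableAt_laplace hc
    (differentiable_const ((rayArgument d α w.im : ℂ) * Complex.I)) differentiable_id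
    (s₀ := w) (hray w hw).1 (exp_re_pos (hray w hw).2)
  refine hd.congr_of_eventuallyEq ?_
  have hnear : ∀ᶠ v : ℂ in 𝓝 w,
      |((rayArgument d α w.im : ℂ) * Complex.I - v).im| < Real.pi / 2 :=
    (isOpen_lt (by fun_prop) continuous_const).mem_nhds (hray w hw).2
  filter_upwards [hnear, hopen.mem_nhds hw] with v hv hvG
  exact H.laplace_eq hc (hray v hvG).1 (hray v hvG).2 (hray w hw).1 hv

theorem DenominatorBound.hasGevreyExpansion_borelSum (H : DenominatorBound a h d δ c) (hc : 0 < c)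
    (hh : 1 ≤ h) {α : ℝ} (hα : 1 < α) (hδ : (α - 1) * (Real.pi / 2) ≤ δ) :
    HasGevreyExpansion 1 (unboundedSector d α) (borelSum a h d α) (factorialSeries a h) := by
  intro T hT
  have hα0 : 0 < α := by linarith
  have hα1 : 0 < 1 - 1 / α := by
    rw [sub_pos, div_lt_one hα0]
    exact hα
  obtain ⟨m, R, hm0, hm, hTb⟩ := hT.exists_bounds
  have hmα : m / α < Real.pi / 2 := by
    rw [div_lt_iff₀ hα0]
    linarith
  -- On `T` the angle between `z` and its ray is at most `m / α < π / 2`, so `q` bounds its cosine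
  -- from below.
  set q := Real.cos (m / α)
  have hq : 0 < q := Real.cos_pos_of_mem_Ioo
    ⟨by linarith [Real.pi_pos, div_nonneg hm0 hα0.le], hmα⟩
  have hq1 : 1 ≤ q⁻¹ := (one_le_inv₀ hq).2 (Real.cos_le_one _)
  set R' := max 1 R
  set B := max 1 ‖a‖
  have hR' : 1 ≤ R' := le_max_left _ _
  have hB : 1 ≤ B := le_max_left _ _
  -- The remainder has exponent `n = h * M + 1` with `N ≤ n ≤ N + h`. Passing from `n` to `N` costs
  -- `2 ^ (N + h) * h!` in the factorial and `R' ^ h` in the modulus; `N`-th powers go into the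
  -- second constant, the rest into the first. The maxima with `1` in `R'` and `B` allow exponents
  -- to be raised.
  refine ⟨2 ^ h * h.factorial * R' ^ h * q⁻¹ ^ (h + 1) / c, 2 * B * q⁻¹, by positivity,
    by positivity, fun N w hw => ?_⟩
  obtain ⟨hwm, hwR⟩ := hTb w hw
  have hwR' : w.modulus ≤ R' := hwR.trans (le_max_right _ _)
  set ρ := w.modulus with hρ_def
  have hρ : 0 < ρ := Real.exp_pos _
  set τ : ℂ := (rayArgument d α w.im : ℂ) * Complex.I with hτ_def
  have hτim : τ.im = rayArgument d α w.im := by simp [hτ_def]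
  have hτre : τ.re = 0 := by simp [hτ_def]
  have hτd : |τ.im - d| < δ := by
    rw [hτim, abs_rayArgument_sub hα]
    calc (1 - 1 / α) * |w.im - d| < (1 - 1 / α) * (Real.pi * α / 2) := by
          gcongr
          exact hwm.trans_lt hm
      _ = (α - 1) * (Real.pi / 2) := by field_simp
      _ ≤ δ := hδ
  have hnorm : ‖Complex.exp (τ - w)‖ = ρ⁻¹ := by
    rw [Complex.norm_exp, Complex.sub_re, hτre, zero_sub, Real.exp_neg, hρ_def, LogSurface.modulus]
  have hre : ρ⁻¹ * q ≤ (Complex.exp (τ - w)).re := by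
    rw [Complex.exp_re, ← Complex.norm_exp, hnorm, ← Real.cos_abs (τ - w).im, Complex.sub_im, hτim,
      abs_rayArgument_sub_self hα]
    gcongr
    refine Real.cos_le_cos_of_nonneg_of_le_pi (by positivity) (by linarith [Real.pi_pos]) ?_
    gcongr
  obtain ⟨M, hNM, hMN, hMN', hsum⟩ := exists_sum_coeff_factorialSeries a hh w.toComplex N
  have hbound := H.norm_laplace_sub_le hc hτd ((by positivity : 0 < ρ⁻¹ * q).trans_le hre) M
  rw [hsum, Real.rpow_one]
  refine hbound.trans ?_
  have hnormτ : ‖Complex.exp τ‖ = 1 := Complex.norm_exp_ofReal_mul_I _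
  rw [hnorm, hnormτ, one_pow, mul_one]
  set n := h * M + 1
  have hfact : (n.factorial : ℝ) ≤ 2 ^ (N + h) * N.factorial * h.factorial := by
    exact_mod_cast (Nat.factorial_le hMN).trans (factorial_add_le N h)
  have hρn : ρ ^ n ≤ R' ^ h * ρ ^ N := by
    obtain ⟨j, hj⟩ := Nat.exists_eq_add_of_le hNM
    rw [hj, pow_add, mul_comm]
    gcongr
    exact (pow_le_pow_left₀ hρ.le hwR' j).trans (pow_le_pow_right₀ hR' (by omega))
  have hqn : q⁻¹ ^ (n + 1) ≤ q⁻¹ ^ (N + h + 1) := pow_le_pow_right₀ hq1 (by omega)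
  have haM : ‖a‖ ^ M ≤ B ^ N :=
    (pow_le_pow_left₀ (norm_nonneg a) (le_max_right _ _) M).trans (pow_le_pow_right₀ hB hMN')
  calc ‖a‖ ^ M * ρ⁻¹ / c * (n.factorial / (Complex.exp (τ - w)).re ^ (n + 1))
      ≤ ‖a‖ ^ M * ρ⁻¹ / c * (n.factorial / (ρ⁻¹ * q) ^ (n + 1)) := by gcongr
    _ = ‖a‖ ^ M * n.factorial * q⁻¹ ^ (n + 1) * ρ ^ n / c := by
        rw [mul_pow, inv_pow, inv_pow]
        field_simp
        ring
    _ ≤ B ^ N * (2 ^ (N + h) * N.factorial * h.factorial) * q⁻¹ ^ (N + h + 1) *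
          (R' ^ h * ρ ^ N) / c := by gcongr
    _ = _ := by
        rw [mul_pow, mul_pow]
        ring

end GevreySummability

theorem mainTheorem7 (a : ℂ) (h : ℕ) (hh : 1 ≤ h) (d : ℝ)
    (hd : ∀ ζ : ℂ, a ≠ 0 → ζ ^ h = 1 / a → ¬ GevreySummability.IsArgumentOf d ζ) :
    GevreySummability.IsSummableInDirection 1 d (GevreySummability.factorialSeries a h) := by
  obtain ⟨δ, c, hδ, hc, H⟩ := GevreySummability.exists_denominatorBound hh hd
  have hπ := Real.pi_pos
  -- This opening is the largest with `(α - 1) * (π / 2) ≤ δ`, so every ray used stays where the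
  -- denominator is controlled.
  have hα : 1 < 1 + 2 * δ / Real.pi := lt_add_of_pos_right 1 (by positivity)
  have hαδ : (1 + 2 * δ / Real.pi - 1) * (Real.pi / 2) ≤ δ := by
    apply le_of_eq
    field_simp
    ring
  rw [GevreySummability.IsSummableInDirection, div_one]
  exact ⟨GevreySummability.isGevreyOfOrder_factorialSeries a hh, 1 + 2 * δ / Real.pi,
    GevreySummability.unboundedSector d (1 + 2 * δ / Real.pi),
    GevreySummability.borelSum a h d (1 + 2 * δ / Real.pi), hα,
    GevreySummability.isSectorialRegion_unboundedSector d (by positivity),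
    H.differentiableOn_borelSum hc hα hαδ, H.hasGevreyExpansion_borelSum hc hh hα hαδ⟩
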